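/- Let $\mathbb{D}=\{z\in\mathbb{C}:|z|<1\}$, let $\partial=\tfrac12(\partial_x-i\partial_y)$ and $\bar\partial=\tfrac12(\partial_x+i\partial_y)$ be the Wirtinger derivatives, and put $\xi_m(z)=z^m$ for integers $m\ge 0$ and $\xi_m(z)=\bar z^{|m|}$ for integers $m<0$. Let $F(a,b,c;x)=\sum_{k\ge0}\frac{(a)_k(b)_k}{(c)_k}\frac{x^k}{k!}$, where $(a)_k=a(a+1)\cdots(a+k-1)$, denote the Gauss hypergeometric function. **Theorem (cellular decomposition).** Let $n\ge 1$ be an integer and let $u\in C^{2n}(\mathbb{D})$ be a complex-valued polyharmonic function of order $n$, that is, $\partial^n\bar\partial^n u=0$ in $\mathbb{D}$. Then there are complex numbers $k_{m,j}$ ($m\in\mathbb{Z}$, $0\le j\le n-1$) with $$\limsup_{|m|\to\infty}|k_{m,j}|^{1/|m|}\le 1\qquad(0\le j\le n-1)$$ and functions $w_0,\dots,w_{n-1}\in C^\infty(\mathbb{D})$ such that the following hold. 1. For each $0\le j\le n-1$, $$w_j(z)=\sum_{m=-\infty}^{\infty}k_{m,j}\,F\big(-n+1+j,\;|m|-n+1+j,\;|m|+1;\;|z|^2\big)\,\xi_m(z),\qquad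 z\in\mathbb{D},$$ where the series converges absolutely in $C^\infty(\mathbb{D})$, i.e. absolutely with respect to each of the seminorms $f\mapsto\sup_{z\in K}\|D^rf(z)\|$ with $K\subset\mathbb{D}$ compact and $r\ge 0$ an integer ($D^r$ being the $r$-th real Fréchet derivative). 2. Each $w_j$ is $(n-1-j,n-1-j)$-harmonic: with $\alpha=n-1-j$, $$(1-|z|^2)\,\partial\bar\partial w_j+\alpha z\,\partial w_j+\alpha\bar z\,\bar\partial w_j-\alpha^2w_j=0\quad\text{in }\mathbb{D}.$$ 3. For all $z\in\mathbb{D}$, $$u(z)=w_0(z)+(1-|z|^2)\,w_1(z)+\dots+(1-|z|^2)^{n-1}\,w_{n-1}(z).$$ -/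

import Mathlib

open scoped ContDiff ENNReal ComplexConjugate

noncomputable section

/-- The Wirtinger derivative `∂ f = (∂f/∂x - i ∂f/∂y) / 2`. -/
def wirtinger (f : ℂ → ℂ) (z : ℂ) : ℂ :=
  (fderiv ℝ f z 1 - Complex.I * fderiv ℝ f z Complex.I) / 2

/-- The Wirtinger derivative `∂̄ f = (∂f/∂x + i ∂f/∂y) / 2`. -/
def wirtingerBar (f : ℂ → ℂ) (z : ℂ) : ℂ :=
  (fderiv ℝ f z 1 + Complex.I * fderiv ℝ f z Complex.I) / 2

/-- The open unit disc. Functions on the disc are represented by functions on `ℂ`; since the disc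
is open, the values outside it do not enter into any of the notions below. -/
def unitDisc : Set ℂ := Metric.ball 0 1

/-- `u ∈ C^{2n}(𝔻)` is polyharmonic of order `n`: `∂ⁿ ∂̄ⁿ u = 0` in `𝔻`. -/
def IsPolyharmonic (n : ℕ) (u : ℂ → ℂ) : Prop :=
  ContDiffOn ℝ ((2 * n : ℕ) : WithTop ℕ∞) u unitDisc ∧
    ∀ z ∈ unitDisc, (wirtinger^[n] (wirtingerBar^[n] u)) z = 0

/-- The operator `L_{γ₁,γ₂} = (1 - |z|²) ∂∂̄ + γ₁ z ∂ + γ₂ z̄ ∂̄ - γ₁ γ₂`. -/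
def harmonicOp (γ₁ γ₂ : ℂ) (u : ℂ → ℂ) (z : ℂ) : ℂ :=
  (1 - (‖z‖ : ℂ) ^ 2) * wirtinger (wirtingerBar u) z + γ₁ * z * wirtinger u z
    + γ₂ * conj z * wirtingerBar u z - γ₁ * γ₂ * u z

/-- `u ∈ C²(𝔻)` is `(γ₁, γ₂)`-harmonic: `L_{γ₁,γ₂} u = 0` in `𝔻`. -/
def IsGenHarmonic (γ₁ γ₂ : ℂ) (u : ℂ → ℂ) : Prop :=
  ContDiffOn ℝ 2 u unitDisc ∧ ∀ z ∈ unitDisc, harmonicOp γ₁ γ₂ u z = 0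

/-- `ξ_m(z) = z^m` for `m ≥ 0` and `ξ_m(z) = z̄^{|m|}` for `m < 0`. -/
def xi (m : ℤ) (z : ℂ) : ℂ :=
  if 0 ≤ m then z ^ m.natAbs else conj z ^ m.natAbs

/-- The function `z ↦ F(-n+1+j, |m|-n+1+j, |m|+1; |z|²) ξ_m(z)`, with Mathlib's
Gauss hypergeometric function. -/
def cellTerm (n j : ℕ) (m : ℤ) (z : ℂ) : ℂ :=
  ordinaryHypergeometric (-(n : ℂ) + 1 + j) ((m.natAbs : ℂ) - n + 1 + j) ((m.natAbs : ℂ) + 1)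
    ((‖z‖ : ℂ) ^ 2) * xi m z

/-- `limsup_{|m| → ∞} |k_m|^{1/|m|} ≤ 1`, with the upper limit taken in `[0, ∞]`. -/
def RootLimsupLeOne (k : ℤ → ℂ) : Prop :=
  Filter.limsup (fun m : ℤ => ‖k m‖ₑ ^ (1 / (m.natAbs : ℝ))) Filter.cofinite ≤ 1

/-- The seminorms `sup_{z ∈ K} ‖D^r f(z)‖` which define the topology of `C^∞(𝔻)`
as `K` runs through the compact subsets of `𝔻` and `r` through `ℕ`. -/
def smoothSeminorm (K : Set ℂ) (r : ℕ) (f : ℂ → ℂ) : ℝ≥0∞ :=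
  ⨆ z ∈ K, ‖iteratedFDeriv ℝ r f z‖ₑ

/-- The series `∑_m f_m` of smooth functions on `𝔻` converges absolutely in `C^∞(𝔻)`,
with sum the smooth function `w`. -/
def HasSmoothSum (f : ℤ → ℂ → ℂ) (w : ℂ → ℂ) : Prop :=
  (∀ m, ContDiffOn ℝ ∞ (f m) unitDisc) ∧ ContDiffOn ℝ ∞ w unitDisc ∧
    ∀ K ⊆ unitDisc, IsCompact K → ∀ r : ℕ,
      (∑' m, smoothSeminorm K r (f m)) < ⊤ ∧
      Filter.Tendsto (fun s : Finset ℤ => smoothSeminorm K r (fun z => (∑ m ∈ s, f m z) - w z))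
        Filter.atTop (nhds 0)

end

/-!
By Almansi's argument, integrating first in `∂` and then in `∂̄`, a polyharmonic function of order
`n` is `∑_{k < n} (zᵏ Gₖ(z̄) + fₖ(z) z̄ᵏ)` with `Gₖ` and `fₖ` holomorphic. Expanding these in Taylor
series gives `u = ∑_m Q_m(|z|²) ξ_m`, where `Q` is a polynomial of degree less than `n` over the
ring of two-sided sequences of subexponential growth.

Over this ring `Q` can be divided successively by `1 - X`, with a multiple of the hypergeometric
polynomial of degree at most `n - 1 - j` as the `j`-th remainder: by the Chu–Vandermonde identity
the value of that polynomial at `1` is a unit, i.e. it is bounded above and below up to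
subexponential factors. The remainders are the cells. They are annihilated by `L_{α,α}` because the
recurrence of the hypergeometric coefficients makes the sum over the monomials telescope.
-/

open Filter Polynomial Topology

/-! ### Wirtinger derivatives -/

lemma isOpen_unitDisc : IsOpen unitDisc := Metric.isOpen_ball

lemma mem_unitDisc_iff {z : ℂ} : z ∈ unitDisc ↔ ‖z‖ < 1 := mem_ball_zero_iff

lemma conj_mem_unitDisc {z : ℂ} (hz : z ∈ unitDisc) : conj z ∈ unitDisc := by
  simpa only [mem_unitDisc_iff, Complex.norm_conj] using hz

/-- The Wirtinger derivative `∂` as a linear functional of the real Fréchet derivative. -/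
noncomputable def wirtingerCLM : (ℂ →L[ℝ] ℂ) →L[ℝ] ℂ :=
  (2 : ℂ)⁻¹ • (.apply ℝ ℂ (1 : ℂ) - Complex.I • .apply ℝ ℂ Complex.I)

/-- The Wirtinger derivative `∂̄` as a linear functional of the real Fréchet derivative. -/
noncomputable def wirtingerBarCLM : (ℂ →L[ℝ] ℂ) →L[ℝ] ℂ :=
  (2 : ℂ)⁻¹ • (.apply ℝ ℂ (1 : ℂ) + Complex.I • .apply ℝ ℂ Complex.I)

lemma wirtingerCLM_apply (L : ℂ →L[ℝ] ℂ) :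
    wirtingerCLM L = (L 1 - Complex.I * L Complex.I) / 2 :=
  (div_eq_inv_mul _ _).symm

lemma wirtingerBarCLM_apply (L : ℂ →L[ℝ] ℂ) :
    wirtingerBarCLM L = (L 1 + Complex.I * L Complex.I) / 2 :=
  (div_eq_inv_mul _ _).symm

lemma wirtinger_eq_wirtingerCLM_fderiv (f : ℂ → ℂ) :
    wirtinger f = fun z => wirtingerCLM (fderiv ℝ f z) :=
  funext fun _ => (wirtingerCLM_apply _).symm

lemma wirtingerBar_eq_wirtingerBarCLM_fderiv (f : ℂ → ℂ) :
    wirtingerBar f = fun z => wirtingerBarCLM (fderiv ℝ f z) :=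
  funext fun _ => (wirtingerBarCLM_apply _).symm

lemma wirtinger_congr {f g : ℂ → ℂ} {z : ℂ} (h : f =ᶠ[𝓝 z] g) : wirtinger f z = wirtinger g z := by
  rw [wirtinger, wirtinger, h.fderiv_eq]

lemma wirtingerBar_add {f g : ℂ → ℂ} {z : ℂ} (hf : DifferentiableAt ℝ f z)
    (hg : DifferentiableAt ℝ g z) :
    wirtingerBar (fun w => f w + g w) z = wirtingerBar f z + wirtingerBar g z := by
  simp only [wirtingerBar_eq_wirtingerBarCLM_fderiv, fderiv_fun_add hf hg, map_add]

lemma wirtingerBar_sub {f g : ℂ → ℂ} {z : ℂ} (hf : DifferentiableAt ℝ f z)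
    (hg : DifferentiableAt ℝ g z) :
    wirtingerBar (fun w => f w - g w) z = wirtingerBar f z - wirtingerBar g z := by
  simp only [wirtingerBar_eq_wirtingerBarCLM_fderiv, fderiv_fun_sub hf hg, map_sub]

lemma fderiv_const_mul_apply (c : ℂ) (f : ℂ → ℂ) (z h : ℂ) :
    fderiv ℝ (fun z => c * f z) z h = c * fderiv ℝ f z h :=
  DFunLike.congr_fun (congrFun (fderiv_const_smul_field (𝕜 := ℝ) (f := f) c) z) h

lemma wirtinger_const_mul (c : ℂ) (f : ℂ → ℂ) :
    wirtinger (fun z => c * f z) = fun z => c * wirtinger f z := by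
  ext z
  simp only [wirtinger, fderiv_const_mul_apply]
  ring

lemma wirtingerBar_const_mul (c : ℂ) (f : ℂ → ℂ) :
    wirtingerBar (fun z => c * f z) = fun z => c * wirtingerBar f z := by
  ext z
  simp only [wirtingerBar, fderiv_const_mul_apply]
  ring

lemma wirtinger_sum {ι : Type*} (s : Finset ι) {f : ι → ℂ → ℂ} {z : ℂ}
    (hf : ∀ i ∈ s, DifferentiableAt ℝ (f i) z) :
    wirtinger (fun w => ∑ i ∈ s, f i w) z = ∑ i ∈ s, wirtinger (f i) z := by
  simp only [wirtinger_eq_wirtingerCLM_fderiv, fderiv_fun_sum hf, map_sum]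

lemma wirtingerBar_sum {ι : Type*} (s : Finset ι) {f : ι → ℂ → ℂ} {z : ℂ}
    (hf : ∀ i ∈ s, DifferentiableAt ℝ (f i) z) :
    wirtingerBar (fun w => ∑ i ∈ s, f i w) z = ∑ i ∈ s, wirtingerBar (f i) z := by
  simp only [wirtingerBar_eq_wirtingerBarCLM_fderiv, fderiv_fun_sum hf, map_sum]

lemma hasFDerivAt_mul_comp_conj {f g : ℂ → ℂ} {a b z : ℂ} (hf : HasDerivAt f a z)
    (hg : HasDerivAt g b (conj z)) :
    HasFDerivAt (𝕜 := ℝ) (fun w => f w * g (conj w))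
      (f z • b • (Complex.conjCLE : ℂ →L[ℝ] ℂ) + g (conj z) • a • .id ℝ ℂ) z := by
  have hf_real : HasFDerivAt (𝕜 := ℝ) f (a • .id ℝ ℂ) z :=
    hf.complexToReal_fderiv.congr_fderiv (by ext; simp)
  have hg_real : HasFDerivAt (𝕜 := ℝ) (fun w => g (conj w))
      (b • (Complex.conjCLE : ℂ →L[ℝ] ℂ)) z :=
    (hg.complexToReal_fderiv.comp z (Complex.conjCLE : ℂ →L[ℝ] ℂ).hasFDerivAt).congr_fderiv
      (by ext; simp)
  exact hf_real.mul hg_real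

lemma wirtinger_mul_comp_conj {f g : ℂ → ℂ} {a b z : ℂ} (hf : HasDerivAt f a z)
    (hg : HasDerivAt g b (conj z)) :
    wirtinger (fun w => f w * g (conj w)) z = a * g (conj z) := by
  rw [wirtinger, (hasFDerivAt_mul_comp_conj hf hg).fderiv]
  simp only [add_apply, smul_apply, ContinuousLinearEquiv.coe_coe,
    ContinuousAlgEquiv.coeCLE_apply, Complex.conjCAE_apply, map_one, smul_eq_mul, mul_one,
    ContinuousLinearMap.id_apply, Complex.conj_I, mul_neg]
  linear_combination (f z * b / 2 - g (conj z) * a / 2) * Complex.I_sq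

lemma wirtingerBar_mul_comp_conj {f g : ℂ → ℂ} {a b z : ℂ} (hf : HasDerivAt f a z)
    (hg : HasDerivAt g b (conj z)) :
    wirtingerBar (fun w => f w * g (conj w)) z = f z * b := by
  rw [wirtingerBar, (hasFDerivAt_mul_comp_conj hf hg).fderiv]
  simp only [add_apply, smul_apply, ContinuousLinearEquiv.coe_coe,
    ContinuousAlgEquiv.coeCLE_apply, Complex.conjCAE_apply, map_one, smul_eq_mul, mul_one,
    ContinuousLinearMap.id_apply, Complex.conj_I, mul_neg]
  linear_combination (-(f z * b) / 2 + g (conj z) * a / 2) * Complex.I_sq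

lemma wirtingerBar_comp_conj (f : ℂ → ℂ) : wirtingerBar (f ∘ conj) = wirtinger f ∘ conj := by
  ext z
  have chain : fderiv ℝ (f ∘ conj) z =
      (fderiv ℝ f (conj z)).comp (Complex.conjCLE : ℂ →L[ℝ] ℂ) :=
    Complex.conjCLE.comp_right_fderiv
  simp [wirtingerBar, wirtinger, chain, sub_eq_add_neg]

lemma wirtingerBar_iterate_comp_conj (k : ℕ) (f : ℂ → ℂ) :
    wirtingerBar^[k] (f ∘ conj) = wirtinger^[k] f ∘ conj :=
  have semiconj : Function.Semiconj (fun f : ℂ → ℂ => f ∘ conj) wirtinger wirtingerBar :=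
    fun f => (wirtingerBar_comp_conj f).symm
  (semiconj.iterate_right k f).symm

lemma contDiffOn_wirtingerBar {k : ℕ} {f : ℂ → ℂ} {s : Set ℂ} (hs : IsOpen s)
    (hf : ContDiffOn ℝ ((k + 1 : ℕ) : WithTop ℕ∞) f s) :
    ContDiffOn ℝ (k : WithTop ℕ∞) (wirtingerBar f) s := by
  rw [wirtingerBar_eq_wirtingerBarCLM_fderiv]
  exact wirtingerBarCLM.contDiff.comp_contDiffOn (hf.fderiv_of_isOpen hs (by norm_cast))

lemma contDiffOn_wirtingerBar_iterate {k : ℕ} (l : ℕ) {f : ℂ → ℂ} {s : Set ℂ} (hs : IsOpen s)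
    (hf : ContDiffOn ℝ ((k + l : ℕ) : WithTop ℕ∞) f s) :
    ContDiffOn ℝ (k : WithTop ℕ∞) (wirtingerBar^[l] f) s := by
  induction l generalizing f with
  | zero => exact hf
  | succ l ih => exact ih (contDiffOn_wirtingerBar (k := k + l) hs hf)

lemma differentiableAt_of_wirtingerBar_eq_zero {f : ℂ → ℂ} {z : ℂ}
    (hf : DifferentiableAt ℝ f z) (h : wirtingerBar f z = 0) : DifferentiableAt ℂ f z := by
  rw [differentiableAt_complex_iff_differentiableAt_real]
  refine ⟨hf, ?_⟩
  rw [wirtingerBar] at h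
  rw [smul_eq_mul]
  linear_combination (-2 * Complex.I) * h + fderiv ℝ f z Complex.I * Complex.I_sq

/-! ### Almansi sums -/

lemma hasDerivAt_pow_succ_div {𝕜 : Type*} [NontriviallyNormedField 𝕜] [CharZero 𝕜] (k : ℕ) (w : 𝕜) :
    HasDerivAt (fun w : 𝕜 => w ^ (k + 1) / (k + 1)) (w ^ k) w := by
  refine ((hasDerivAt_pow (k + 1) w).div_const _).congr_deriv ?_
  rw [Nat.add_sub_cancel, Nat.cast_succ, mul_div_cancel_left₀ _ (Nat.cast_add_one_ne_zero k)]

/-- The functions `∑_{k < p} zᵏ Gₖ(z̄) + ∑_{k < q} fₖ(z) z̄ᵏ` on the disc with `Gₖ` and `fₖ`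
holomorphic, which are the `C^{p + q}` solutions of `∂ᵖ ∂̄^q u = 0`. -/
def IsAlmansiSum (p q : ℕ) (u : ℂ → ℂ) : Prop :=
  ∃ G f : ℕ → ℂ → ℂ, (∀ k, DifferentiableOn ℂ (G k) unitDisc) ∧
    (∀ k, DifferentiableOn ℂ (f k) unitDisc) ∧
    ∀ z ∈ unitDisc, u z = ∑ k ∈ Finset.range p, z ^ k * G k (conj z) +
      ∑ k ∈ Finset.range q, f k z * conj z ^ k

namespace IsAlmansiSum

variable {p q : ℕ} {u : ℂ → ℂ}

protected lemma zero (hu : ∀ z ∈ unitDisc, u z = 0) : IsAlmansiSum 0 0 u :=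
  ⟨0, 0, fun _ => differentiableOn_const 0, fun _ => differentiableOn_const 0,
    fun z hz => by simp [hu z hz]⟩

lemma comp_conj (hu : IsAlmansiSum p q u) : IsAlmansiSum q p (u ∘ conj) := by
  obtain ⟨G, f, hG, hf, rep⟩ := hu
  refine ⟨f, G, hf, hG, fun z hz => ?_⟩
  simp [rep _ (conj_mem_unitDisc hz), mul_comm, add_comm]

lemma add_holomorphic (hu : IsAlmansiSum p (q + 1) u) {h : ℂ → ℂ}
    (hh : DifferentiableOn ℂ h unitDisc) : IsAlmansiSum p (q + 1) (fun z => u z + h z) := by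
  obtain ⟨G, f, hG, hf, rep⟩ := hu
  refine ⟨G, fun | 0 => fun z => f 0 z + h z | k + 1 => f (k + 1), hG, ?_, fun z hz => ?_⟩
  · rintro (_ | k)
    exacts [(hf 0).add hh, hf (k + 1)]
  · simp only [rep z hz, Finset.sum_range_succ']
    ring

lemma exists_wirtingerBar_eq {v : ℂ → ℂ} (hv : IsAlmansiSum p q v) :
    ∃ H, IsAlmansiSum p (q + 1) H ∧
      ∀ z ∈ unitDisc, DifferentiableAt ℝ H z ∧ wirtingerBar H z = v z := by
  obtain ⟨G, f, hG, hf, rep⟩ := hv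
  choose P hP using fun k => (hG k).isExactOn_ball
  have deriv_P (k : ℕ) {z : ℂ} (hz : z ∈ unitDisc) : HasDerivAt (P k) (G k (conj z)) (conj z) :=
    hP k _ (conj_mem_unitDisc hz)
  have deriv_f (k : ℕ) {z : ℂ} (hz : z ∈ unitDisc) : HasDerivAt (f k) (deriv (f k) z) z :=
    ((hf k).differentiableAt (isOpen_unitDisc.mem_nhds hz)).hasDerivAt
  let M (k : ℕ) (w : ℂ) : ℂ := w ^ (k + 1) / (k + 1)
  have deriv_M (k : ℕ) (w : ℂ) : HasDerivAt (M k) (w ^ k) w := hasDerivAt_pow_succ_div k w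
  have diff_P (k : ℕ) {z : ℂ} (hz : z ∈ unitDisc) :
      DifferentiableAt ℝ (fun w => w ^ k * P k (conj w)) z :=
    (hasFDerivAt_mul_comp_conj (hasDerivAt_pow k z) (deriv_P k hz)).differentiableAt
  have diff_M (k : ℕ) {z : ℂ} (hz : z ∈ unitDisc) :
      DifferentiableAt ℝ (fun w => f k w * M k (conj w)) z :=
    (hasFDerivAt_mul_comp_conj (deriv_f k hz) (deriv_M k _)).differentiableAt
  refine ⟨fun z => ∑ k ∈ Finset.range p, z ^ k * P k (conj z) +
    ∑ k ∈ Finset.range q, f k z * M k (conj z), ?_, fun z hz => ⟨?_, ?_⟩⟩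
  · refine ⟨P, fun | 0 => 0 | k + 1 => fun z => f k z / (k + 1), fun k z hz =>
      (hP k z hz).differentiableAt.differentiableWithinAt, ?_, fun z _ => ?_⟩
    · rintro (_ | k)
      exacts [differentiableOn_const 0, (hf k).div_const _]
    · rw [Finset.sum_range_succ']
      simp [M, mul_div_assoc, div_mul_eq_mul_div]
  · exact (DifferentiableAt.fun_sum fun k _ => diff_P k hz).fun_add
      (DifferentiableAt.fun_sum fun k _ => diff_M k hz)
  · rw [wirtingerBar_add (.fun_sum fun k _ => diff_P k hz) (.fun_sum fun k _ => diff_M k hz),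
      wirtingerBar_sum _ fun k _ => diff_P k hz, wirtingerBar_sum _ fun k _ => diff_M k hz,
      rep z hz]
    simp only [wirtingerBar_mul_comp_conj (hasDerivAt_pow _ z) (deriv_P _ hz),
      wirtingerBar_mul_comp_conj (deriv_f _ hz) (deriv_M _ _)]

lemma of_wirtingerBar (hu : DifferentiableOn ℝ u unitDisc)
    (h : IsAlmansiSum p q (wirtingerBar u)) : IsAlmansiSum p (q + 1) u := by
  obtain ⟨H, hH, H_deriv⟩ := h.exists_wirtingerBar_eq
  have holomorphic_sub : DifferentiableOn ℂ (fun z => u z - H z) unitDisc := by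
    intro z hz
    obtain ⟨H_diff, H_bar⟩ := H_deriv z hz
    have u_diff := hu.differentiableAt (isOpen_unitDisc.mem_nhds hz)
    refine (differentiableAt_of_wirtingerBar_eq_zero (u_diff.fun_sub H_diff)
      ?_).differentiableWithinAt
    rw [wirtingerBar_sub u_diff H_diff, H_bar, sub_self]
  simpa only [add_sub_cancel] using hH.add_holomorphic holomorphic_sub

lemma of_wirtingerBar_iterate {N : ℕ} (hu : ContDiffOn ℝ N u unitDisc)
    (h : IsAlmansiSum p q (wirtingerBar^[N] u)) : IsAlmansiSum p (q + N) u := by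
  induction N generalizing u with
  | zero => exact h
  | succ N ih =>
    exact of_wirtingerBar (hu.differentiableOn (by exact_mod_cast N.succ_ne_zero))
      (ih (contDiffOn_wirtingerBar isOpen_unitDisc hu) h)

lemma of_wirtinger_iterate {N : ℕ} (hu : ContDiffOn ℝ N u unitDisc)
    (h : IsAlmansiSum p q (wirtinger^[N] u)) : IsAlmansiSum (p + N) q u := by
  have hu_conj : ContDiffOn ℝ N (u ∘ conj) unitDisc :=
    hu.comp Complex.conjCLE.contDiff.contDiffOn fun _ => conj_mem_unitDisc
  have := (of_wirtingerBar_iterate hu_conj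
    (wirtingerBar_iterate_comp_conj N u ▸ h.comp_conj)).comp_conj
  simpa [Function.comp_def] using this

end IsAlmansiSum

lemma IsPolyharmonic.isAlmansiSum {n : ℕ} {u : ℂ → ℂ} (hu : IsPolyharmonic n u) :
    IsAlmansiSum n n u := by
  obtain ⟨smooth, vanish⟩ := hu
  have bar_smooth : ContDiffOn ℝ n (wirtingerBar^[n] u) unitDisc :=
    contDiffOn_wirtingerBar_iterate n isOpen_unitDisc (two_mul n ▸ smooth)
  have bar_sum : IsAlmansiSum n 0 (wirtingerBar^[n] u) := by
    simpa using (IsAlmansiSum.zero vanish).of_wirtinger_iterate bar_smooth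
  simpa using bar_sum.of_wirtingerBar_iterate (smooth.of_le (by norm_cast; lia))

/-! ### Sequences of subexponential growth -/

lemma tendsto_int_natAbs_cofinite : Tendsto Int.natAbs cofinite atTop := by
  rw [← Nat.cofinite_eq_atTop]
  exact Tendsto.cofinite_of_finite_preimage_singleton fun n =>
    (Set.finite_Icc (-(n : ℤ)) n).subset fun m hm => by
      simp only [Set.mem_preimage, Set.mem_singleton_iff] at hm
      exact Set.mem_Icc.mpr (by lia)

lemma summable_pow_natAbs {r : ℝ} (hr_nonneg : 0 ≤ r) (hr_lt_one : r < 1) :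
    Summable fun m : ℤ => r ^ m.natAbs :=
  have geometric := summable_geometric_of_lt_one hr_nonneg hr_lt_one
  .of_nat_of_neg (by simpa using geometric) (by simpa using geometric)

/-- The algebra of two-sided complex sequences `a` with `a m = O(ρ^|m|)` for every `ρ > 1`. -/
noncomputable def subexponential : Subalgebra ℂ (ℤ → ℂ) where
  carrier := {a | ∀ ρ : ℝ, 1 < ρ → a =O[cofinite] fun m : ℤ => ρ ^ m.natAbs}
  mul_mem' {a b} ha hb ρ hρ := by
    have one_lt_sqrt : 1 < √ρ := Real.lt_sqrt_of_sq_lt (by simpa)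
    refine ((ha _ one_lt_sqrt).mul (hb _ one_lt_sqrt)).congr_right fun m => ?_
    rw [← mul_pow, Real.mul_self_sqrt (by linarith)]
  add_mem' ha hb ρ hρ := (ha ρ hρ).add (hb ρ hρ)
  algebraMap_mem' c ρ hρ :=
    .of_bound ‖c‖ <| .of_forall fun m => le_mul_of_one_le_right (norm_nonneg c) <| by
      simpa [abs_of_pos (zero_lt_one.trans hρ)] using one_le_pow₀ hρ.le

lemma mem_subexponential_of_isBigO_one {a : ℤ → ℂ} (ha : a =O[cofinite] fun _ => (1 : ℝ)) :
    a ∈ subexponential := fun ρ hρ =>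
  ha.trans <| .of_bound 1 <| .of_forall fun m => by
    simpa [abs_of_pos (zero_lt_one.trans hρ)] using one_le_pow₀ hρ.le

lemma natAbs_mem_subexponential : (fun m : ℤ => (m.natAbs : ℂ)) ∈ subexponential := fun _ hρ =>
  have little_o := isLittleO_pow_const_const_pow_of_one_lt (R := ℂ) 1 hρ
  (little_o.isBigO.congr_left fun _ => pow_one _).comp_tendsto tendsto_int_natAbs_cofinite

lemma const_mem_subexponential (c : ℂ) : (fun _ : ℤ => c) ∈ subexponential :=
  subexponential.algebraMap_mem c

lemma eval_mem_subexponential (P : ℂ[X]) {a : ℤ → ℂ} (ha : a ∈ subexponential) :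
    (fun m => P.eval (a m)) ∈ subexponential := by
  have aeval_mem := (aeval (⟨a, ha⟩ : subexponential) P).2
  rwa [coe_aeval_mk_apply, aeval_pi_apply] at aeval_mem

lemma single_mem_subexponential (m : ℤ) (c : ℂ) : Pi.single m c ∈ subexponential :=
  mem_subexponential_of_isBigO_one <| .of_bound ‖c‖ <| .of_forall fun k => by
    rw [Pi.single_apply]
    split_ifs <;> simp

lemma summable_norm_mul_pow_natAbs {a : ℤ → ℂ} (ha : a ∈ subexponential) {r : ℝ}
    (hr_pos : 0 < r) (hr_lt_one : r < 1) : Summable fun m : ℤ => ‖a m‖ * r ^ m.natAbs := by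
  obtain ⟨s, hrs, hs⟩ := exists_between hr_lt_one
  have growth : a =O[cofinite] fun m : ℤ => (s / r) ^ m.natAbs :=
    ha _ ((one_lt_div hr_pos).mpr hrs)
  refine summable_of_isBigO (summable_pow_natAbs (hr_pos.trans hrs).le hs) ?_
  refine (growth.norm_left.mul (Asymptotics.isBigO_refl (fun m : ℤ => r ^ m.natAbs) _)).congr_right
    fun m => ?_
  rw [← mul_pow, div_mul_cancel₀ _ hr_pos.ne']

lemma eventually_norm_le_pow_of_mem_subexponential {a : ℤ → ℂ} (ha : a ∈ subexponential) {c : ℝ}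
    (hc : 1 < c) : ∀ᶠ m in cofinite, ‖a m‖ ≤ c ^ m.natAbs := by
  obtain ⟨ρ, hρ, hρc⟩ := exists_between hc
  have little_o : (fun m : ℤ => ρ ^ m.natAbs) =o[cofinite] fun m : ℤ => c ^ m.natAbs :=
    (isLittleO_pow_pow_of_lt_left (by linarith) hρc).comp_tendsto tendsto_int_natAbs_cofinite
  filter_upwards [((ha ρ hρ).trans_isLittleO little_o).bound one_pos] with m hm
  simpa [abs_of_pos (zero_lt_one.trans hc)] using hm

lemma rootLimsupLeOne_of_mem_subexponential {a : ℤ → ℂ} (ha : a ∈ subexponential) :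
    RootLimsupLeOne a := by
  refine le_of_forall_gt_imp_ge_of_dense fun c hc => ?_
  obtain ⟨d, one_lt_d, hdc⟩ := exists_between hc
  lift d to NNReal using hdc.ne_top
  refine le_trans (limsup_le_of_le (by isBoundedDefault) (a := (d : ℝ≥0∞)) ?_) hdc.le
  filter_upwards [eventually_norm_le_pow_of_mem_subexponential ha (c := d)
      (by exact_mod_cast one_lt_d),
    tendsto_int_natAbs_cofinite.eventually_ne_atTop 0] with m hm hm_ne
  have enorm_le : ‖a m‖ₑ ≤ (d : ℝ≥0∞) ^ m.natAbs := by
    rw [enorm_eq_nnnorm]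
    exact_mod_cast hm
  rw [one_div, ENNReal.rpow_inv_le_iff (by positivity), ENNReal.rpow_natCast]
  exact enorm_le

/-- The value of a sequence at an index. -/
noncomputable def subexponentialEval (m : ℤ) : subexponential →+* ℂ :=
  (Pi.evalRingHom (fun _ : ℤ => ℂ) m).comp subexponential.subtype

/-- The substitution `m ↦ -m` of the index. -/
noncomputable def subexponentialReflect : subexponential →+* subexponential where
  toFun a := ⟨fun m => a.1 (-m), fun ρ hρ => by
    simpa [Function.comp_def] using
      (a.2 ρ hρ).comp_tendsto (neg_injective (G := ℤ)).tendsto_cofinite⟩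
  map_zero' := rfl
  map_one' := rfl
  map_add' _ _ := rfl
  map_mul' _ _ := rfl

/-! ### Terminating hypergeometric series -/

section Hypergeometric

lemma descPochhammer_int_smeval_eq_eval {R : Type*} [CommRing R] (k : ℕ) (r : R) :
    (descPochhammer ℤ k).smeval r = (descPochhammer R k).eval r := by
  rw [descPochhammer_smeval_eq_ascPochhammer, ascPochhammer_smeval_eq_eval,
    descPochhammer_eval_eq_ascPochhammer]

variable {K : Type*} [Field K]

lemma ordinaryHypergeometricCoefficient_succ [CharZero K] (a b : K) {c : K} {i : ℕ}
    (hc : c + i ≠ 0) :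
    (i + 1) * (c + i) * ordinaryHypergeometricCoefficient a b c (i + 1) =
      (a + i) * (b + i) * ordinaryHypergeometricCoefficient a b c i := by
  have : (i : K) + 1 ≠ 0 := Nat.cast_add_one_ne_zero i
  simp only [ordinaryHypergeometricCoefficient, ascPochhammer_succ_eval, Nat.factorial_succ,
    Nat.cast_mul, Nat.cast_succ, mul_inv]
  field_simp

lemma ordinaryHypergeometricCoefficient_neg_natCast_eq_zero {N i : ℕ} (h : N < i) (b c : K) :
    ordinaryHypergeometricCoefficient (-(N : K)) b c i = 0 := by
  simp [ordinaryHypergeometricCoefficient, ascPochhammer_eval_neg_coe_nat_of_lt h]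

lemma ordinaryHypergeometricCoefficient_neg_natCast [CharZero K] (N i : ℕ) (b c : K) :
    ordinaryHypergeometricCoefficient (-(N : K)) b c i =
      N.choose i * (descPochhammer K i).eval (-b) * ((ascPochhammer K i).eval c)⁻¹ := by
  have factorial_ne : (i.factorial : K) ≠ 0 := Nat.cast_ne_zero.mpr i.factorial_ne_zero
  have sign_sq : ((-1 : K) ^ i) * (-1) ^ i = 1 := by rw [← mul_pow]; simp
  have asc_b := ascPochhammer_eval_neg_eq_descPochhammer K (-b) i
  rw [neg_neg] at asc_b
  rw [ordinaryHypergeometricCoefficient, ascPochhammer_eval_neg_eq_descPochhammer, asc_b,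
    descPochhammer_eval_eq_descFactorial, Nat.descFactorial_eq_factorial_mul_choose, Nat.cast_mul]
  field_simp
  linear_combination (N.choose i * (descPochhammer K i).eval (-b) *
    ((ascPochhammer K i).eval c)⁻¹) * sign_sq

/-- The Chu–Vandermonde identity, with denominators cleared. -/
theorem sum_ordinaryHypergeometricCoefficient_neg_natCast_mul [CharZero K] (N : ℕ) (b c : K)
    (hc : ∀ i ≤ N, (ascPochhammer K i).eval c ≠ 0) :
    (∑ i ∈ Finset.range (N + 1), ordinaryHypergeometricCoefficient (-(N : K)) b c i) *
      (ascPochhammer K N).eval c = (ascPochhammer K N).eval (c - b) := by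
  have split (i : ℕ) (hi : i ≤ N) : (ascPochhammer K N).eval c =
      (ascPochhammer K i).eval c * (descPochhammer K (N - i)).eval (c + N - 1) := by
    have arg : c + N - 1 - (N - i : ℕ) + 1 = c + i := by
      rw [Nat.cast_sub hi]
      ring
    rw [descPochhammer_eval_eq_ascPochhammer, arg]
    simpa [hi] using (congrArg (eval c) (ascPochhammer_mul K i (N - i))).symm
  calc _ = ∑ i ∈ Finset.range (N + 1), N.choose i * ((descPochhammer K i).eval (-b) *
        (descPochhammer K (N - i)).eval (c + N - 1)) := by
        rw [Finset.sum_mul]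
        refine Finset.sum_congr rfl fun i hi => ?_
        have hi := Finset.mem_range_succ_iff.mp hi
        rw [ordinaryHypergeometricCoefficient_neg_natCast, split i hi]
        field_simp [hc i hi]
    _ = (descPochhammer K N).eval (-b + (c + N - 1)) := by
        simp only [← descPochhammer_int_smeval_eq_eval]
        rw [Ring.descPochhammer_smeval_add N (Commute.all _ _),
          Finset.Nat.sum_antidiagonal_eq_sum_range_succ_mk]
    _ = _ := by rw [descPochhammer_eval_eq_ascPochhammer]; congr 1; ring

theorem ordinaryHypergeometric_neg_natCast [TopologicalSpace K] [IsTopologicalRing K] (N : ℕ)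
    (b c x : K) : ordinaryHypergeometric (-(N : K)) b c x =
      ∑ i ∈ Finset.range (N + 1), ordinaryHypergeometricCoefficient (-(N : K)) b c i * x ^ i := by
  rw [ordinaryHypergeometric_eq_tsum]
  exact tsum_eq_sum fun i hi => mul_eq_zero_of_left
    (ordinaryHypergeometricCoefficient_neg_natCast_eq_zero (by simpa using hi) b c) _

end Hypergeometric

/-- Successive division by `C a - X`: `k j` is found by comparing values at `a`, where `F j` is a
unit. -/
theorem exists_eq_sum_C_sub_X_pow_mul {R : Type*} [CommRing R] (a : R) (n : ℕ) (F : ℕ → R[X])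
    (unit_at : ∀ j < n, IsUnit ((F j).eval a)) (natDegree_lt : ∀ j < n, (F j).natDegree + j < n)
    (Q : R[X]) (hQ : Q.degree < n) :
    ∃ k : ℕ → R, Q = ∑ j ∈ Finset.range n, C (k j) * (C a - X) ^ j * F j := by
  nontriviality R
  induction n generalizing F Q with
  | zero => exact ⟨0, by simpa using hQ⟩
  | succ n ih =>
    obtain ⟨v, hv⟩ := (unit_at 0 n.succ_pos).exists_right_inv
    obtain ⟨S, hS⟩ : X - C a ∣ Q - C (Q.eval a * v) * F 0 := by
      rw [dvd_iff_isRoot, IsRoot.def, eval_sub, eval_mul, eval_C]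
      linear_combination -(Q.eval a) * hv
    have remainder_degree : (C (Q.eval a * v) * F 0).degree < (n + 1 : ℕ) :=
      degree_le_natDegree.trans_lt <| by
        exact_mod_cast (natDegree_C_mul_le _ _).trans_lt (natDegree_lt 0 n.succ_pos)
    have S_degree : (-S).degree < n := by
      have := (degree_sub_le _ _).trans_lt (max_lt hQ remainder_degree)
      rw [hS, mul_comm, (monic_X_sub_C a).degree_mul, degree_X_sub_C] at this
      rw [degree_neg]
      exact lt_of_add_lt_add_right (by exact_mod_cast this)
    obtain ⟨k, hk⟩ := ih (fun j => F (j + 1)) (fun j hj => unit_at _ (by lia))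
      (fun j hj => by have := natDegree_lt (j + 1) (by lia); lia) (-S) S_degree
    refine ⟨fun | 0 => Q.eval a * v | j + 1 => k j, ?_⟩
    have tail : ∑ j ∈ Finset.range n, C (k j) * (C a - X) ^ (j + 1) * F (j + 1) =
        (C a - X) * -S := by
      rw [hk, Finset.mul_sum]
      exact Finset.sum_congr rfl fun j _ => by ring
    rw [Finset.sum_range_succ', tail]
    linear_combination hS

/-! ### Cell polynomials -/

lemma ascPochhammer_eval_natCast_add_one (M k : ℕ) :
    (ascPochhammer ℂ k).eval ((M : ℂ) + 1) = (M + 1).ascFactorial k := by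
  rw [← ascPochhammer_nat_eq_ascFactorial, ← Nat.cast_succ, ascPochhammer_eval_cast]

lemma ascPochhammer_eval_natCast_add_one_ne_zero (M k : ℕ) :
    (ascPochhammer ℂ k).eval ((M : ℂ) + 1) ≠ 0 := by
  rw [ascPochhammer_eval_natCast_add_one]
  exact_mod_cast (Nat.ascFactorial_pos M k).ne'

lemma inv_ascPochhammer_mem_subexponential (k : ℕ) :
    (fun m : ℤ => ((ascPochhammer ℂ k).eval ((m.natAbs : ℂ) + 1))⁻¹) ∈ subexponential :=
  mem_subexponential_of_isBigO_one <| .of_bound 1 <| .of_forall fun m => by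
    rw [ascPochhammer_eval_natCast_add_one, norm_inv, Complex.norm_natCast, norm_one, mul_one]
    exact inv_le_one_of_one_le₀ (by exact_mod_cast Nat.ascFactorial_pos _ k)

/-- The `i`-th Taylor coefficients of `x ↦ F(-N, |m| - N, |m| + 1; x)`, `m ∈ ℤ`. -/
noncomputable def cellCoeff (N i : ℕ) : subexponential :=
  ⟨fun m => ordinaryHypergeometricCoefficient (-(N : ℂ)) (m.natAbs - N) (m.natAbs + 1) i,
    mul_mem (mul_mem (const_mem_subexponential _) (eval_mem_subexponential _
      (sub_mem natAbs_mem_subexponential (const_mem_subexponential N))))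
      (inv_ascPochhammer_mem_subexponential i)⟩

/-- The polynomials `F(-N, |m| - N, |m| + 1; X)`, `m ∈ ℤ`, as a single polynomial whose
coefficients are sequences in `m`. -/
noncomputable def cellPoly (N : ℕ) : subexponential[X] :=
  ∑ i ∈ Finset.range (N + 1), C (cellCoeff N i) * X ^ i

lemma natDegree_cellPoly_le (N : ℕ) : (cellPoly N).natDegree ≤ N :=
  natDegree_sum_le_of_forall_le _ _ fun _ hi =>
    (natDegree_C_mul_X_pow_le _ _).trans (Finset.mem_range_succ_iff.mp hi)

lemma isUnit_eval_one_cellPoly (N : ℕ) : IsUnit ((cellPoly N).eval 1) := by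
  let numerator : subexponential := ⟨fun m => (ascPochhammer ℂ N).eval ((m.natAbs : ℂ) + 1),
    eval_mem_subexponential _ (add_mem natAbs_mem_subexponential (const_mem_subexponential 1))⟩
  let scale : subexponential :=
    ⟨_, const_mem_subexponential ((ascPochhammer ℂ N).eval (N + 1 : ℂ))⁻¹⟩
  refine .of_mul_eq_one (numerator * scale) (Subtype.ext (funext fun m => ?_))
  have eval_one : subexponentialEval m ((cellPoly N).eval 1) = ∑ i ∈ Finset.range (N + 1),
      ordinaryHypergeometricCoefficient (-(N : ℂ)) (m.natAbs - N) (m.natAbs + 1) i := by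
    rw [cellPoly, eval_finsetSum, map_sum]
    exact Finset.sum_congr rfl fun i _ => by simp [cellCoeff, subexponentialEval]
  have chu_vandermonde := sum_ordinaryHypergeometricCoefficient_neg_natCast_mul N
    (m.natAbs - N : ℂ) (m.natAbs + 1) fun i _ => ascPochhammer_eval_natCast_add_one_ne_zero _ i
  change subexponentialEval m ((cellPoly N).eval 1) * ((ascPochhammer ℂ N).eval (m.natAbs + 1 : ℂ) *
    ((ascPochhammer ℂ N).eval (N + 1 : ℂ))⁻¹) = 1
  rw [eval_one, ← mul_assoc, chu_vandermonde,
    show (m.natAbs + 1 - (m.natAbs - N) : ℂ) = N + 1 by ring,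
    mul_inv_cancel₀ (ascPochhammer_eval_natCast_add_one_ne_zero N N)]

/-! ### Normally convergent series of smooth functions -/

/-- Normal convergence of `∑ᵢ f i` on the compact subsets of `s`. -/
def NormallySummableOn {ι E F : Type*} [TopologicalSpace E] [Norm F] (f : ι → E → F) (s : Set E) :
    Prop :=
  ∀ K ⊆ s, IsCompact K → ∃ v : ι → ℝ, Summable v ∧ ∀ i, ∀ x ∈ K, ‖f i x‖ ≤ v i

/-- Normal convergence of `∑ᵢ f i` with all derivatives on the compact subsets of `s`, i.e. absolute
convergence in `C^∞(s)`. -/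
def SmoothlySummableOn {ι E F : Type*} [NormedAddCommGroup E] [NormedSpace ℝ E]
    [NormedAddCommGroup F] [NormedSpace ℝ F] (f : ι → E → F) (s : Set E) : Prop :=
  (∀ i, ContDiffOn ℝ ∞ (f i) s) ∧ ∀ k, NormallySummableOn (fun i => iteratedFDeriv ℝ k (f i)) s

lemma NormallySummableOn.summable {ι E F : Type*} [TopologicalSpace E] [NormedAddCommGroup F]
    [CompleteSpace F] {f : ι → E → F} {s : Set E} (hf : NormallySummableOn f s) {x : E}
    (hx : x ∈ s) : Summable fun i => f i x :=
  have ⟨_, hv, bound⟩ := hf {x} (Set.singleton_subset_iff.mpr hx) isCompact_singleton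
  .of_norm_bounded hv fun i => bound i x rfl

section NormalConvergence

variable {ι E F : Type*} [NormedAddCommGroup E] [NormedSpace ℝ E] [NormedAddCommGroup F]
  [NormedSpace ℝ F] {f g : ι → E → F} {s : Set E}

lemma NormallySummableOn.hasFDerivAt_tsum [LocallyCompactSpace E] [CompleteSpace F] (hs : IsOpen s)
    (hf : NormallySummableOn f s) (diff : ∀ i, DifferentiableOn ℝ (f i) s)
    (hf' : NormallySummableOn (fun i => fderiv ℝ (f i)) s) {x : E} (hx : x ∈ s) :
    HasFDerivAt (fun y => ∑' i, f i y) (∑' i, fderiv ℝ (f i) x) x := by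
  have uniform : TendstoLocallyUniformlyOn (fun t y => ∑ i ∈ t, fderiv ℝ (f i) y)
      (fun y => ∑' i, fderiv ℝ (f i) y) atTop s :=
    (tendstoLocallyUniformlyOn_iff_forall_isCompact hs).mpr fun K hK K_compact =>
      have ⟨_, hv, bound⟩ := hf' K hK K_compact
      tendstoUniformlyOn_tsum hv bound
  exact hasFDerivAt_of_tendstoLocallyUniformlyOn hs uniform
    (fun t y hy => .fun_sum fun i _ => ((diff i).differentiableAt (hs.mem_nhds hy)).hasFDerivAt)
    (fun y hy => (hf.summable hy).hasSum) hx

namespace SmoothlySummableOn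

lemma normallySummableOn (hf : SmoothlySummableOn f s) : NormallySummableOn f s :=
  fun K hK K_compact => by simpa only [norm_iteratedFDeriv_zero] using hf.2 0 K hK K_compact

lemma summable [CompleteSpace F] (hf : SmoothlySummableOn f s) {x : E} (hx : x ∈ s) :
    Summable fun i => f i x :=
  hf.normallySummableOn.summable hx

lemma add (hs : IsOpen s) (hf : SmoothlySummableOn f s) (hg : SmoothlySummableOn g s) :
    SmoothlySummableOn (fun i x => f i x + g i x) s := by
  refine ⟨fun i => (hf.1 i).add (hg.1 i), fun k K hK K_compact => ?_⟩
  obtain ⟨v, hv, hfv⟩ := hf.2 k K hK K_compact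
  obtain ⟨w, hw, hgw⟩ := hg.2 k K hK K_compact
  refine ⟨fun i => v i + w i, hv.add hw, fun i x hx => ?_⟩
  have at_x := hs.mem_nhds (hK hx)
  have derivative_add := fun_iteratedFDeriv_add_apply (i := k)
    (((hf.1 i).contDiffAt at_x).of_le (by exact_mod_cast le_top))
    (((hg.1 i).contDiffAt at_x).of_le (by exact_mod_cast le_top))
  exact (congrArg norm derivative_add).trans_le (norm_add_le_of_le (hfv i x hx) (hgw i x hx))

lemma fderiv (hs : IsOpen s) (hf : SmoothlySummableOn f s) :
    SmoothlySummableOn (fun i => fderiv ℝ (f i)) s := by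
  refine ⟨fun i => (hf.1 i).fderiv_of_isOpen hs (by simp), fun k K hK K_compact => ?_⟩
  obtain ⟨v, hv, bound⟩ := hf.2 (k + 1) K hK K_compact
  exact ⟨v, hv, fun i x hx => norm_iteratedFDeriv_fderiv.trans_le (bound i x hx)⟩

lemma clm_comp {G : Type*} [NormedAddCommGroup G] [NormedSpace ℝ G] (L : F →L[ℝ] G) (hs : IsOpen s)
    (hf : SmoothlySummableOn f s) : SmoothlySummableOn (fun i x => L (f i x)) s := by
  refine ⟨fun i => L.contDiff.comp_contDiffOn (hf.1 i), fun k K hK K_compact => ?_⟩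
  obtain ⟨v, hv, bound⟩ := hf.2 k K hK K_compact
  refine ⟨fun i => ‖L‖ * v i, hv.mul_left _, fun i x hx => ?_⟩
  exact (L.norm_iteratedFDeriv_comp_left ((hf.1 i).contDiffAt (hs.mem_nhds (hK hx)))
    (by exact_mod_cast le_top)).trans (mul_le_mul_of_nonneg_left (bound i x hx) (norm_nonneg L))

section tsum

variable [LocallyCompactSpace E] [CompleteSpace F]

lemma hasFTaylorSeriesUpToOn_tsum (hs : IsOpen s) (hf : SmoothlySummableOn f s) :
    HasFTaylorSeriesUpToOn ∞ (fun x => ∑' i, f i x)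
      (fun x k => ∑' i, iteratedFDeriv ℝ k (f i) x) s := by
  have diff (k : ℕ) (i : ι) : DifferentiableOn ℝ (iteratedFDeriv ℝ k (f i)) s := fun x hx =>
    (((hf.1 i).contDiffAt (hs.mem_nhds hx)).differentiableAt_iteratedFDeriv
      (by exact_mod_cast WithTop.coe_lt_top _)).differentiableWithinAt
  have fderiv_summable (k : ℕ) :
      NormallySummableOn (fun i => _root_.fderiv ℝ (iteratedFDeriv ℝ k (f i))) s :=
    fun K hK K_compact => by
      simpa only [norm_fderiv_iteratedFDeriv] using hf.2 (k + 1) K hK K_compact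
  have deriv (k : ℕ) {x : E} (hx : x ∈ s) :=
    (hf.2 k).hasFDerivAt_tsum hs (diff k) (fderiv_summable k) hx
  refine ⟨fun x _ => ?_, fun k _ x hx => (deriv k hx).hasFDerivWithinAt.congr_fderiv ?_,
    fun k _ x hx => (deriv k hx).continuousAt.continuousWithinAt⟩
  · exact (continuousMultilinearCurryFin0 ℝ E F).toContinuousLinearEquiv.map_tsum
      (f := fun i => iteratedFDeriv ℝ 0 (f i) x)
  · simp_rw [fderiv_iteratedFDeriv]
    exact (ContinuousLinearEquiv.map_tsum (continuousMultilinearCurryLeftEquiv ℝ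
      (fun _ : Fin (k + 1) => E) F).toContinuousLinearEquiv).symm

lemma contDiffOn_tsum (hs : IsOpen s) (hf : SmoothlySummableOn f s) :
    ContDiffOn ℝ ∞ (fun x => ∑' i, f i x) s :=
  (hf.hasFTaylorSeriesUpToOn_tsum hs).contDiffOn

lemma iteratedFDeriv_tsum (hs : IsOpen s) (hf : SmoothlySummableOn f s) (k : ℕ) {x : E}
    (hx : x ∈ s) :
    iteratedFDeriv ℝ k (fun y => ∑' i, f i y) x = ∑' i, iteratedFDeriv ℝ k (f i) x := by
  rw [← iteratedFDerivWithin_of_isOpen k hs hx]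
  exact ((hf.hasFTaylorSeriesUpToOn_tsum hs).eq_iteratedFDerivWithin_of_uniqueDiffOn
    (by exact_mod_cast le_top) hs.uniqueDiffOn hx).symm

lemma hasSum_clm_fderiv {G : Type*} [NormedAddCommGroup G] [NormedSpace ℝ G]
    (L : (E →L[ℝ] F) →L[ℝ] G) (hs : IsOpen s) (hf : SmoothlySummableOn f s) {x : E}
    (hx : x ∈ s) : HasSum (fun i => L (_root_.fderiv ℝ (f i) x))
      (L (_root_.fderiv ℝ (fun y => ∑' i, f i y) x)) := by
  have fderiv_summable := hf.fderiv hs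
  rw [(hf.normallySummableOn.hasFDerivAt_tsum hs (fun i => (hf.1 i).differentiableOn (by simp))
    fderiv_summable.normallySummableOn hx).fderiv]
  exact L.hasSum (fderiv_summable.summable hx).hasSum

end tsum

end SmoothlySummableOn

end NormalConvergence

lemma smoothSeminorm_le_ofReal {K : Set ℂ} {r : ℕ} {f : ℂ → ℂ} {c : ℝ}
    (h : ∀ z ∈ K, ‖iteratedFDeriv ℝ r f z‖ ≤ c) : smoothSeminorm K r f ≤ .ofReal c :=
  iSup₂_le fun z hz => (ofReal_norm _).symm.trans_le (ENNReal.ofReal_le_ofReal (h z hz))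

namespace SmoothlySummableOn

variable {f : ℤ → ℂ → ℂ}

lemma hasSum_harmonicOp (hf : SmoothlySummableOn f unitDisc) (γ₁ γ₂ : ℂ) {z : ℂ}
    (hz : z ∈ unitDisc) : HasSum (fun m => harmonicOp γ₁ γ₂ (f m) z)
      (harmonicOp γ₁ γ₂ (fun z => ∑' m, f m z) z) := by
  have hasSum_wirtinger {g : ℤ → ℂ → ℂ} (hg : SmoothlySummableOn g unitDisc) :
      HasSum (fun m => wirtinger (g m) z) (wirtinger (fun z => ∑' m, g m z) z) := by
    simpa only [wirtinger_eq_wirtingerCLM_fderiv] using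
      hg.hasSum_clm_fderiv wirtingerCLM isOpen_unitDisc hz
  have hasSum_wirtingerBar {w : ℂ} (hw : w ∈ unitDisc) :
      HasSum (fun m => wirtingerBar (f m) w) (wirtingerBar (fun z => ∑' m, f m z) w) := by
    simpa only [wirtingerBar_eq_wirtingerBarCLM_fderiv] using
      hf.hasSum_clm_fderiv wirtingerBarCLM isOpen_unitDisc hw
  have summable_wirtingerBar : SmoothlySummableOn (fun m => wirtingerBar (f m)) unitDisc := by
    simpa only [wirtingerBar_eq_wirtingerBarCLM_fderiv] using
      (hf.fderiv isOpen_unitDisc).clm_comp wirtingerBarCLM isOpen_unitDisc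
  have laplacian := hasSum_wirtinger summable_wirtingerBar
  rw [wirtinger_congr (isOpen_unitDisc.eventually_mem hz |>.mono fun w hw =>
    (hasSum_wirtingerBar hw).tsum_eq)] at laplacian
  exact (((laplacian.mul_left _).add ((hasSum_wirtinger hf).mul_left _)).add
    ((hasSum_wirtingerBar hz).mul_left _)).sub ((hf.summable hz).hasSum.mul_left _)

lemma isGenHarmonic_tsum (hf : SmoothlySummableOn f unitDisc) {γ₁ γ₂ : ℂ}
    (harmonic : ∀ m, ∀ z ∈ unitDisc, harmonicOp γ₁ γ₂ (f m) z = 0) :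
    IsGenHarmonic γ₁ γ₂ (fun z => ∑' m, f m z) := by
  refine ⟨contDiffOn_infty.mp (hf.contDiffOn_tsum isOpen_unitDisc) 2, fun z hz => ?_⟩
  rw [← (hf.hasSum_harmonicOp γ₁ γ₂ hz).tsum_eq]
  simp only [harmonic _ z hz, tsum_zero]

lemma iteratedFDeriv_sum_sub_tsum (hf : SmoothlySummableOn f unitDisc) (t : Finset ℤ) (r : ℕ)
    {z : ℂ} (hz : z ∈ unitDisc) :
    iteratedFDeriv ℝ r (fun z => (∑ m ∈ t, f m z) - ∑' m, f m z) z =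
      (∑ m ∈ t, iteratedFDeriv ℝ r (f m) z) - ∑' m, iteratedFDeriv ℝ r (f m) z := by
  have at_z := isOpen_unitDisc.mem_nhds hz
  have smooth (m : ℤ) : ContDiffAt ℝ r (f m) z :=
    ((hf.1 m).contDiffAt at_z).of_le (by exact_mod_cast le_top)
  have smooth_tsum : ContDiffAt ℝ r (fun z => ∑' m, f m z) z :=
    ((hf.contDiffOn_tsum isOpen_unitDisc).contDiffAt at_z).of_le (by exact_mod_cast le_top)
  rw [fun_iteratedFDeriv_sub_apply (.sum fun m _ => smooth m) smooth_tsum,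
    iteratedFDeriv_fun_sum_apply fun m _ => smooth m, hf.iteratedFDeriv_tsum isOpen_unitDisc r hz]

lemma hasSmoothSum (hf : SmoothlySummableOn f unitDisc) :
    HasSmoothSum f (fun z => ∑' m, f m z) := by
  refine ⟨hf.1, hf.contDiffOn_tsum isOpen_unitDisc, fun K hK K_compact r => ?_⟩
  obtain ⟨v, hv, bound⟩ := hf.2 r K hK K_compact
  refine ⟨(ENNReal.tsum_le_tsum fun m => smoothSeminorm_le_ofReal (bound m)).trans_lt
    hv.tsum_ofReal_lt_top, ENNReal.tendsto_nhds_zero.mpr fun ε hε => ?_⟩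
  obtain ⟨δ, hδ_pos, hδ⟩ := ENNReal.lt_iff_exists_nnreal_btwn.mp hε
  filter_upwards [Metric.tendstoUniformlyOn_iff.mp (tendstoUniformlyOn_tsum hv bound) δ
    (by exact_mod_cast hδ_pos)] with t ht
  refine (smoothSeminorm_le_ofReal (c := δ) fun z hz => ?_).trans (by simpa using hδ.le)
  rw [hf.iteratedFDeriv_sum_sub_tsum t r (hK hz), ← dist_eq_norm']
  exact (ht z hz).le

end SmoothlySummableOn

/-! ### Monomials in `z` and `z̄` -/

lemma norm_iteratedFDeriv_prod_clm_le {ι 𝕜 E A : Type*} [Fintype ι] [NontriviallyNormedField 𝕜]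
    [NormedAddCommGroup E] [NormedSpace 𝕜 E] [NormedCommRing A] [NormedAlgebra 𝕜 A] [NormOneClass A]
    {L : ι → E →L[𝕜] A} (hL : ∀ i, ‖L i‖ ≤ 1) (r : ℕ) (x : E) :
    ‖iteratedFDeriv 𝕜 r (fun x => ∏ i, L i x) x‖ ≤
      (Fintype.card ι : ℝ) ^ r * ‖x‖ ^ (Fintype.card ι - r) := by
  let M := ContinuousMultilinearMap.mkPiAlgebra 𝕜 ι A
  let g : E →L[𝕜] (ι → A) := .pi L
  have norm_g_apply (x : E) : ‖g x‖ ≤ ‖x‖ :=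
    (pi_norm_le_iff_of_nonneg (norm_nonneg x)).mpr fun i => (L i).le_of_opNorm_le (hL i) x |>.trans
      (one_mul _).le
  have norm_g : ‖g‖ ≤ 1 := g.opNorm_le_bound zero_le_one fun x => by simpa using norm_g_apply x
  have comp : (fun x => ∏ i, L i x) = M ∘ g := by ext x; simp [M, g]
  have norm_M_deriv := M.norm_iteratedFDeriv_le r (g x)
  rw [ContinuousMultilinearMap.norm_mkPiAlgebra, mul_one] at norm_M_deriv
  rw [comp, g.iteratedFDeriv_comp_right M.contDiff x (i := r) (n := ∞) (by exact_mod_cast le_top)]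
  calc _ ≤ ‖iteratedFDeriv 𝕜 r M (g x)‖ * ∏ _ : Fin r, ‖g‖ :=
        ContinuousMultilinearMap.norm_compContinuousLinearMap_le _ _
    _ ≤ ‖iteratedFDeriv 𝕜 r M (g x)‖ := mul_le_of_le_one_right (norm_nonneg _)
        (Finset.prod_le_one (fun _ _ => norm_nonneg _) fun _ _ => norm_g)
    _ ≤ _ := norm_M_deriv
    _ ≤ _ := by
        gcongr
        · exact_mod_cast Nat.descFactorial_le_pow _ r
        · exact norm_g_apply x

lemma norm_iteratedFDeriv_pow_mul_conj_pow_le (a b r : ℕ) (z : ℂ) :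
    ‖iteratedFDeriv ℝ r (fun z : ℂ => z ^ a * conj z ^ b) z‖ ≤
      (a + b : ℝ) ^ r * ‖z‖ ^ (a + b - r) := by
  let L : Fin a ⊕ Fin b → ℂ →L[ℝ] ℂ := Sum.elim (fun _ => .id ℝ ℂ) fun _ => Complex.conjCLE
  have norm_L : ∀ i, ‖L i‖ ≤ 1 := by
    rintro (_ | _)
    exacts [ContinuousLinearMap.norm_id_le, Complex.conjCLE_norm.le]
  simpa [L] using norm_iteratedFDeriv_prod_clm_le norm_L r z

lemma contDiff_pow_mul_conj_pow (a b : ℕ) : ContDiff ℝ ∞ (fun z : ℂ => z ^ a * conj z ^ b) :=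
  (contDiff_id.pow a).mul (Complex.conjCLE.contDiff.pow b)

lemma norm_sq_pow_mul_xi (i : ℕ) (m : ℤ) (z : ℂ) :
    ((‖z‖ : ℂ) ^ 2) ^ i * xi m z = z ^ (m.toNat + i) * conj z ^ ((-m).toNat + i) := by
  rw [← Complex.mul_conj', xi, pow_add, pow_add, mul_pow]
  split_ifs with hm
  · rw [show (-m).toNat = 0 by lia, show m.natAbs = m.toNat by lia]
    ring
  · rw [show m.toNat = 0 by lia, show m.natAbs = (-m).toNat by lia]
    ring

lemma contDiff_norm_sq_pow_mul_xi (i : ℕ) (m : ℤ) :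
    ContDiff ℝ ∞ (fun z : ℂ => ((‖z‖ : ℂ) ^ 2) ^ i * xi m z) := by
  simpa only [norm_sq_pow_mul_xi] using contDiff_pow_mul_conj_pow _ _

lemma norm_iteratedFDeriv_norm_sq_pow_mul_xi_le (i : ℕ) (m : ℤ) (r : ℕ) {ρ : ℝ} (hρ_pos : 0 < ρ)
    (hρ_le : ρ ≤ 1) {z : ℂ} (hz : ‖z‖ ≤ ρ) :
    ‖iteratedFDeriv ℝ r (fun z : ℂ => ((‖z‖ : ℂ) ^ 2) ^ i * xi m z) z‖ ≤
      (m.natAbs + 2 * i : ℝ) ^ r * ((ρ ^ r)⁻¹ * ρ ^ m.natAbs) := by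
  have degree : m.toNat + i + ((-m).toNat + i) = m.natAbs + 2 * i := by lia
  have degree_cast : ((m.toNat + i : ℕ) + ((-m).toNat + i : ℕ) : ℝ) = m.natAbs + 2 * i := by
    exact_mod_cast degree
  have bound := norm_iteratedFDeriv_pow_mul_conj_pow_le (m.toNat + i) ((-m).toNat + i) r z
  rw [degree, degree_cast] at bound
  simp only [norm_sq_pow_mul_xi]
  refine bound.trans (mul_le_mul_of_nonneg_left ?_ (by positivity))
  calc ‖z‖ ^ (m.natAbs + 2 * i - r) ≤ ρ ^ (m.natAbs + 2 * i - r) := by gcongr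
    _ ≤ _ := by
        rw [le_inv_mul_iff₀ (by positivity), ← pow_add]
        exact pow_le_pow_of_le_one hρ_pos.le hρ_le (by lia)

lemma exists_norm_le_of_isCompact_subset_unitDisc {K : Set ℂ} (hK : K ⊆ unitDisc)
    (K_compact : IsCompact K) : ∃ ρ : ℝ, 0 < ρ ∧ ρ < 1 ∧ ∀ z ∈ K, ‖z‖ ≤ ρ :=
  have ⟨ρ, hρ, hKρ⟩ := exists_pos_lt_subset_ball one_pos K_compact.isClosed hK
  ⟨ρ, hρ.1, hρ.2, fun _ hz => (mem_ball_zero_iff.mp (hKρ hz)).le⟩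

lemma smoothlySummableOn_mul_norm_sq_pow_mul_xi {a : ℤ → ℂ} (ha : a ∈ subexponential) (i : ℕ) :
    SmoothlySummableOn (fun m z => a m * (((‖z‖ : ℂ) ^ 2) ^ i * xi m z)) unitDisc := by
  have smooth (m : ℤ) := contDiff_norm_sq_pow_mul_xi i m
  refine ⟨fun m => (contDiff_const.mul (smooth m)).contDiffOn, fun r K hK K_compact => ?_⟩
  obtain ⟨ρ, hρ_pos, hρ_lt, hρ⟩ := exists_norm_le_of_isCompact_subset_unitDisc hK K_compact
  let b : ℤ → ℂ := a * ((fun m : ℤ => (m.natAbs : ℂ)) + fun _ => ((2 * i : ℕ) : ℂ)) ^ r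
  have hb : b ∈ subexponential := mul_mem ha (pow_mem
    (add_mem natAbs_mem_subexponential (const_mem_subexponential _)) r)
  have norm_b (m : ℤ) : ‖b m‖ = ‖a m‖ * (m.natAbs + 2 * i : ℝ) ^ r := by
    simp only [b, Pi.mul_apply, Pi.pow_apply, Pi.add_apply, norm_mul, norm_pow, ← Nat.cast_add,
      Complex.norm_natCast]
    push_cast
    rfl
  refine ⟨fun m => (ρ ^ r)⁻¹ * (‖b m‖ * ρ ^ m.natAbs),
    (summable_norm_mul_pow_natAbs hb hρ_pos hρ_lt).mul_left _, fun m z hz => ?_⟩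
  have derivative_smul := iteratedFDeriv_const_smul_apply (𝕜 := ℝ) (i := r) (a := a m) (x := z)
    ((smooth m).contDiffAt.of_le (by exact_mod_cast le_top))
  calc _ = ‖a m‖ * ‖iteratedFDeriv ℝ r (fun z : ℂ => ((‖z‖ : ℂ) ^ 2) ^ i * xi m z) z‖ :=
        (congrArg norm derivative_smul).trans (norm_smul _ _)
    _ ≤ ‖a m‖ * ((m.natAbs + 2 * i : ℝ) ^ r * ((ρ ^ r)⁻¹ * ρ ^ m.natAbs)) := by
        gcongr
        exact norm_iteratedFDeriv_norm_sq_pow_mul_xi_le i m r hρ_pos hρ_lt.le (hρ z hz)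
    _ = _ := by
        simp only [norm_b]
        ring

/-! ### Radial expansions -/

/-- The function `Q_m(|z|²) ξ_m(z)`, where the coefficients of the polynomial `Q_m` are the `m`-th
terms of the coefficients of `Q`. -/
noncomputable def radialTerm (Q : subexponential[X]) (m : ℤ) (z : ℂ) : ℂ :=
  Q.eval₂ (subexponentialEval m) ((‖z‖ : ℂ) ^ 2) * xi m z

/-- The sum `∑_m Q_m(|z|²) ξ_m(z)`. -/
noncomputable def radialSum (Q : subexponential[X]) (z : ℂ) : ℂ := ∑' m, radialTerm Q m z

lemma radialTerm_add (P Q : subexponential[X]) (m : ℤ) (z : ℂ) :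
    radialTerm (P + Q) m z = radialTerm P m z + radialTerm Q m z := by
  rw [radialTerm, eval₂_add, add_mul, radialTerm, radialTerm]

lemma radialTerm_monomial (i : ℕ) (a : subexponential) (m : ℤ) (z : ℂ) :
    radialTerm (monomial i a) m z = a.1 m * (((‖z‖ : ℂ) ^ 2) ^ i * xi m z) := by
  rw [radialTerm, eval₂_monomial, mul_assoc]
  rfl

lemma radialTerm_C_mul (a : subexponential) (Q : subexponential[X]) (m : ℤ) (z : ℂ) :
    radialTerm (C a * Q) m z = a.1 m * radialTerm Q m z := by
  rw [radialTerm, eval₂_mul, eval₂_C, mul_assoc]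
  rfl

lemma radialTerm_map_algebraMap_mul (p : ℂ[X]) (Q : subexponential[X]) (m : ℤ) (z : ℂ) :
    radialTerm (p.map (algebraMap ℂ subexponential) * Q) m z =
      p.eval ((‖z‖ : ℂ) ^ 2) * radialTerm Q m z := by
  rw [radialTerm, eval₂_mul, eval₂_map, mul_assoc]
  rfl

lemma smoothlySummableOn_radialTerm (Q : subexponential[X]) :
    SmoothlySummableOn (radialTerm Q) unitDisc := by
  induction Q using Polynomial.induction_on' with
  | add P Q hP hQ =>
    exact (funext₂ (radialTerm_add P Q)) ▸ hP.add isOpen_unitDisc hQ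
  | monomial i a =>
    exact (funext₂ (radialTerm_monomial i a)) ▸ smoothlySummableOn_mul_norm_sq_pow_mul_xi a.2 i

lemma radialSum_zero (z : ℂ) : radialSum 0 z = 0 := by
  simp [radialSum, radialTerm]

lemma radialSum_add (P Q : subexponential[X]) {z : ℂ} (hz : z ∈ unitDisc) :
    radialSum (P + Q) z = radialSum P z + radialSum Q z := by
  simp only [radialSum, radialTerm_add]
  exact ((smoothlySummableOn_radialTerm P).summable hz).tsum_add
    ((smoothlySummableOn_radialTerm Q).summable hz)

lemma radialSum_sum {ι : Type*} (s : Finset ι) (Q : ι → subexponential[X]) {z : ℂ}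
    (hz : z ∈ unitDisc) : radialSum (∑ i ∈ s, Q i) z = ∑ i ∈ s, radialSum (Q i) z :=
  map_sum (AddMonoidHom.mk' (radialSum · z) fun P Q => radialSum_add P Q hz) Q s

lemma radialSum_map_algebraMap_mul (p : ℂ[X]) (Q : subexponential[X]) (z : ℂ) :
    radialSum (p.map (algebraMap ℂ subexponential) * Q) z =
      p.eval ((‖z‖ : ℂ) ^ 2) * radialSum Q z := by
  simp only [radialSum, radialTerm_map_algebraMap_mul, tsum_mul_left]

lemma xi_neg_natCast (k : ℕ) (z : ℂ) : xi (-k) z = conj z ^ k := by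
  rcases k with _ | k
  · simp [xi]
  · rw [xi, if_neg (by lia), Int.natAbs_neg, Int.natAbs_natCast]

lemma xi_neg_conj (m : ℤ) (z : ℂ) : xi (-m) (conj z) = xi m z := by
  have at_conj := norm_sq_pow_mul_xi 0 (-m) (conj z)
  have at_z := norm_sq_pow_mul_xi 0 m z
  simp only [pow_zero, one_mul, add_zero, neg_neg, Complex.conj_conj] at at_conj at_z
  rw [at_conj, at_z, mul_comm]

lemma radialSum_map_reflect (Q : subexponential[X]) (z : ℂ) :
    radialSum (Q.map subexponentialReflect) z = radialSum Q (conj z) := by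
  rw [radialSum, ← (Equiv.neg ℤ).tsum_eq]
  refine tsum_congr fun m => ?_
  have reindex : (subexponentialEval (-m)).comp subexponentialReflect = subexponentialEval m :=
    RingHom.ext fun a => congrArg a.1 (neg_neg m)
  have xi_reflect := xi_neg_conj m (conj z)
  rw [Complex.conj_conj] at xi_reflect
  rw [Equiv.neg_apply, radialTerm, radialTerm, eval₂_map, reindex, xi_reflect, Complex.norm_conj]

lemma extend_mem_subexponential {a : ℕ → ℂ} (ha : ∀ z ∈ unitDisc, Summable fun p => a p * z ^ p) :
    Function.extend ((↑) : ℕ → ℤ) a 0 ∈ subexponential := fun ρ hρ => by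
  have ρ_pos : 0 < ρ := zero_lt_one.trans hρ
  have inv_mem : ((ρ⁻¹ : ℝ) : ℂ) ∈ unitDisc := by
    rw [mem_unitDisc_iff, Complex.norm_real, Real.norm_of_nonneg (inv_pos.mpr ρ_pos).le]
    exact inv_lt_one_of_one_lt₀ hρ
  obtain ⟨c, hc⟩ := (ha _ inv_mem).tendsto_atTop_zero.norm.bddAbove_range
  refine .of_bound c <| .of_forall fun m => ?_
  by_cases hm : ∃ p : ℕ, (p : ℤ) = m
  · obtain ⟨p, rfl⟩ := hm
    have term_le : ‖a p‖ * (ρ ^ p)⁻¹ ≤ c := by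
      simpa [abs_of_pos ρ_pos] using hc ⟨p, rfl⟩
    rw [Nat.cast_injective.extend_apply, Int.natAbs_natCast,
      Real.norm_of_nonneg (pow_pos ρ_pos p).le]
    exact (mul_inv_le_iff₀ (pow_pos ρ_pos p)).mp term_le
  · have c_nonneg : 0 ≤ c := (norm_nonneg _).trans (hc ⟨0, rfl⟩)
    rw [Function.extend_apply' _ _ _ hm, Pi.zero_apply, norm_zero]
    positivity

/-- On the disc `u` is a sum `∑_m Q_m(|z|²) ξ_m(z)` with polynomials `Q_m` of degree less than `n`
whose coefficients have subexponential growth in `m`. -/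
def HasRadialExpansion (n : ℕ) (u : ℂ → ℂ) : Prop :=
  ∃ Q : subexponential[X], Q.degree < n ∧ ∀ z ∈ unitDisc, u z = radialSum Q z

namespace HasRadialExpansion

variable {n : ℕ} {u v : ℂ → ℂ}

lemma mono {l : ℕ} (hu : HasRadialExpansion l u) (hl : l ≤ n) : HasRadialExpansion n u :=
  have ⟨Q, hQ, expansion⟩ := hu
  ⟨Q, hQ.trans_le (by exact_mod_cast hl), expansion⟩

lemma congr (hu : HasRadialExpansion n u) (huv : ∀ z ∈ unitDisc, v z = u z) :
    HasRadialExpansion n v :=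
  have ⟨Q, hQ, expansion⟩ := hu
  ⟨Q, hQ, fun z hz => (huv z hz).trans (expansion z hz)⟩

lemma add (hu : HasRadialExpansion n u) (hv : HasRadialExpansion n v) :
    HasRadialExpansion n (u + v) :=
  have ⟨P, hP, expansion_u⟩ := hu
  have ⟨Q, hQ, expansion_v⟩ := hv
  ⟨P + Q, (degree_add_le P Q).trans_lt (max_lt hP hQ), fun z hz => by
    rw [radialSum_add P Q hz, Pi.add_apply, expansion_u z hz, expansion_v z hz]⟩

protected lemma sum {ι : Type*} {s : Finset ι} {u : ι → ℂ → ℂ}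
    (hu : ∀ i ∈ s, HasRadialExpansion n (u i)) : HasRadialExpansion n (∑ i ∈ s, u i) :=
  Finset.sum_induction u (HasRadialExpansion n) (fun _ _ => add)
    ⟨0, by simp, fun z _ => (radialSum_zero z).symm⟩ hu

lemma comp_conj (hu : HasRadialExpansion n u) : HasRadialExpansion n (u ∘ conj) :=
  have ⟨Q, hQ, expansion⟩ := hu
  ⟨Q.map subexponentialReflect, degree_map_le.trans_lt hQ, fun z hz =>
    (expansion _ (conj_mem_unitDisc hz)).trans (radialSum_map_reflect Q z).symm⟩

lemma norm_sq_mul (hu : HasRadialExpansion n u) :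
    HasRadialExpansion (n + 1) (fun z => (‖z‖ : ℂ) ^ 2 * u z) := by
  obtain ⟨Q, hQ, expansion⟩ := hu
  refine ⟨X * Q, ?_, fun z hz => ?_⟩
  · rw [degree_lt_iff_coeff_zero] at hQ ⊢
    rintro (_ | i) hi
    exacts [coeff_X_mul_zero Q, (coeff_X_mul Q i).trans (hQ i (Nat.le_of_succ_le_succ hi))]
  · simpa [expansion z hz] using (radialSum_map_algebraMap_mul X Q z).symm

lemma of_hasSum {a : ℤ → ℂ} (ha : a ∈ subexponential)
    (hu : ∀ z ∈ unitDisc, HasSum (fun m => a m * xi m z) (u z)) : HasRadialExpansion 1 u := by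
  refine ⟨C ⟨a, ha⟩, degree_C_le.trans_lt (by norm_num), fun z hz => ?_⟩
  rw [← (hu z hz).tsum_eq, radialSum]
  simp only [radialTerm, eval₂_C]
  rfl

lemma const_mul_xi (c : ℂ) (m : ℤ) : HasRadialExpansion 1 (fun z => c * xi m z) :=
  of_hasSum (single_mem_subexponential m c) fun z _ => by
    simpa using hasSum_single (f := fun k => (Pi.single m c : ℤ → ℂ) k * xi k z) m
      fun k hk => by simp [hk]

lemma of_differentiableOn {f : ℂ → ℂ} (hf : DifferentiableOn ℂ f unitDisc) :
    HasRadialExpansion 1 f := by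
  let a (p : ℕ) : ℂ := (p.factorial : ℂ)⁻¹ * iteratedDeriv p f 0
  have taylor {z : ℂ} (hz : z ∈ unitDisc) : HasSum (fun p => a p * z ^ p) (f z) :=
    (Complex.hasSum_taylorSeries_on_ball hf hz).congr_fun fun p => by
      simp only [a, smul_eq_mul, sub_zero]
      ring
  have growth : Function.extend ((↑) : ℕ → ℤ) a 0 ∈ subexponential :=
    extend_mem_subexponential fun z hz => (taylor hz).summable
  refine of_hasSum growth fun z hz => ?_
  rw [← Nat.cast_injective.hasSum_iff]
  · simpa [Function.comp_def, Nat.cast_injective.extend_apply, xi] using taylor hz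
  · intro m hm
    rw [Function.extend_apply' _ _ _ hm, Pi.zero_apply, zero_mul]

lemma mul_conj_pow (k : ℕ) {f : ℂ → ℂ} (hf : DifferentiableOn ℂ f unitDisc) :
    HasRadialExpansion (k + 1) (fun z => f z * conj z ^ k) := by
  induction k generalizing f with
  | zero => simpa using of_differentiableOn hf
  | succ k ih =>
    have dslope_differentiable : DifferentiableOn ℂ (dslope f 0) unitDisc :=
      (Complex.differentiableOn_dslope (Metric.ball_mem_nhds 0 one_pos)).mpr hf
    refine ((ih dslope_differentiable).norm_sq_mul.add
      ((const_mul_xi (f 0) (-(k + 1 : ℕ))).mono (by lia))).congr fun z _ => ?_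
    have f_eq := sub_smul_dslope f 0 z
    rw [sub_zero, smul_eq_mul] at f_eq
    rw [Pi.add_apply, xi_neg_natCast, ← Complex.mul_conj']
    linear_combination (-conj z ^ (k + 1)) * f_eq

end HasRadialExpansion

lemma IsAlmansiSum.hasRadialExpansion {n : ℕ} {u : ℂ → ℂ} (hu : IsAlmansiSum n n u) :
    HasRadialExpansion n u := by
  obtain ⟨G, f, hG, hf, rep⟩ := hu
  have expansion {f : ℕ → ℂ → ℂ} (hf : ∀ k, DifferentiableOn ℂ (f k) unitDisc) :
      HasRadialExpansion n (∑ k ∈ Finset.range n, fun z => f k z * conj z ^ k) :=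
    .sum fun k hk => (HasRadialExpansion.mul_conj_pow k (hf k)).mono (Finset.mem_range.mp hk)
  refine ((expansion hG).comp_conj.add (expansion hf)).congr fun z hz => ?_
  simp [rep z hz, mul_comm]

/-! ### The cells are generalized harmonic -/

lemma harmonicOp_sum {ι : Type*} (γ₁ γ₂ : ℂ) (s : Finset ι) {f : ι → ℂ → ℂ}
    (hf : ∀ i ∈ s, ContDiff ℝ 2 (f i)) (z : ℂ) :
    harmonicOp γ₁ γ₂ (fun w => ∑ i ∈ s, f i w) z = ∑ i ∈ s, harmonicOp γ₁ γ₂ (f i) z := by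
  have diff {i : ι} (hi : i ∈ s) (w : ℂ) : DifferentiableAt ℝ (f i) w :=
    (hf i hi).differentiable two_ne_zero w
  have diff_bar {i : ι} (hi : i ∈ s) : DifferentiableAt ℝ (wirtingerBar (f i)) z :=
    ((contDiffOn_wirtingerBar (k := 1) isOpen_univ (hf i hi).contDiffOn).contDiffAt
      univ_mem).differentiableAt one_ne_zero
  have bar_sum : wirtingerBar (fun w => ∑ i ∈ s, f i w) =
      fun w => ∑ i ∈ s, wirtingerBar (f i) w :=
    funext fun w => wirtingerBar_sum s fun _ hi => diff hi w
  simp only [harmonicOp, bar_sum, wirtinger_sum s fun _ hi => diff_bar hi,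
    wirtinger_sum s fun _ hi => diff hi z, Finset.mul_sum, Finset.sum_add_distrib,
    Finset.sum_sub_distrib]

lemma harmonicOp_const_mul (γ₁ γ₂ c : ℂ) (f : ℂ → ℂ) (z : ℂ) :
    harmonicOp γ₁ γ₂ (fun z => c * f z) z = c * harmonicOp γ₁ γ₂ f z := by
  simp only [harmonicOp, wirtinger_const_mul, wirtingerBar_const_mul]
  ring

lemma wirtinger_monomial (c : ℂ) (p q : ℕ) :
    wirtinger (fun z => c * (z ^ p * conj z ^ q)) =
      fun z => c * p * (z ^ (p - 1) * conj z ^ q) := by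
  ext z
  have product_rule :=
    wirtinger_mul_comp_conj ((hasDerivAt_pow p z).const_mul c) (hasDerivAt_pow q (conj z))
  simpa only [mul_assoc] using product_rule

lemma wirtingerBar_monomial (c : ℂ) (p q : ℕ) :
    wirtingerBar (fun z => c * (z ^ p * conj z ^ q)) =
      fun z => c * q * (z ^ p * conj z ^ (q - 1)) := by
  ext z
  have product_rule :=
    wirtingerBar_mul_comp_conj (hasDerivAt_pow p z) ((hasDerivAt_pow q (conj z)).const_mul c)
  simpa only [mul_left_comm, mul_assoc] using product_rule

lemma harmonicOp_monomial (γ₁ γ₂ c : ℂ) (p q : ℕ) (z : ℂ) :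
    harmonicOp γ₁ γ₂ (fun z => c * (z ^ p * conj z ^ q)) z =
      c * (p * q * (z ^ (p - 1) * conj z ^ (q - 1)) -
        (p - γ₂) * (q - γ₁) * (z ^ p * conj z ^ q)) := by
  have euler (p : ℕ) (w : ℂ) : (p : ℂ) * w ^ p = p * (w * w ^ (p - 1)) := by
    rcases p with _ | p
    · simp
    · rw [Nat.add_sub_cancel, pow_succ']
  simp only [harmonicOp, wirtingerBar_monomial, wirtinger_monomial, ← Complex.mul_conj']
  linear_combination (c * (q - γ₁) * conj z ^ q) * euler p z +
    (c * (p * (z * z ^ (p - 1)) - γ₂ * z ^ p)) * euler q (conj z)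

lemma cellCoeff_succ (N i : ℕ) (m : ℤ) :
    (i + 1) * (m.natAbs + 1 + i) * (cellCoeff N (i + 1)).1 m =
      (-N + i) * (m.natAbs - N + i) * (cellCoeff N i).1 m :=
  ordinaryHypergeometricCoefficient_succ _ _ (by exact_mod_cast (by lia : m.natAbs + 1 + i ≠ 0))

lemma harmonicOp_cellCoeff_mul (N i : ℕ) (m : ℤ) (z : ℂ) :
    harmonicOp N N (fun z => (cellCoeff N i).1 m * (z ^ (m.toNat + i) * conj z ^ ((-m).toNat + i)))
      z = i * (m.natAbs + i) * (cellCoeff N i).1 m *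
          (z ^ (m.toNat + i - 1) * conj z ^ ((-m).toNat + i - 1)) -
        (i + 1) * (m.natAbs + 1 + i) * (cellCoeff N (i + 1)).1 m *
          (z ^ (m.toNat + i) * conj z ^ ((-m).toNat + i)) := by
  have toNat_mul : (m.toNat : ℂ) * (-m).toNat = 0 := by
    rcases le_total 0 m with hm | hm <;> simp [hm]
  have toNat_add : (m.natAbs : ℂ) = m.toNat + (-m).toNat := by
    exact_mod_cast (by lia : m.natAbs = m.toNat + (-m).toNat)
  have coeff_succ := cellCoeff_succ N i m
  rw [toNat_add] at coeff_succ ⊢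
  rw [harmonicOp_monomial]
  push_cast
  linear_combination ((cellCoeff N i).1 m *
    (z ^ (m.toNat + i - 1) * conj z ^ ((-m).toNat + i - 1) -
      z ^ (m.toNat + i) * conj z ^ ((-m).toNat + i))) * toNat_mul +
    (z ^ (m.toNat + i) * conj z ^ ((-m).toNat + i)) * coeff_succ

lemma radialTerm_cellPoly (N : ℕ) (m : ℤ) (z : ℂ) :
    radialTerm (cellPoly N) m z = ∑ i ∈ Finset.range (N + 1),
      (cellCoeff N i).1 m * (z ^ (m.toNat + i) * conj z ^ ((-m).toNat + i)) := by
  simp only [radialTerm, cellPoly, eval₂_finsetSum, Finset.sum_mul, C_mul_X_pow_eq_monomial,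
    ← norm_sq_pow_mul_xi, eval₂_monomial, mul_assoc]
  rfl

theorem harmonicOp_radialTerm_cellPoly (N : ℕ) (m : ℤ) (z : ℂ) :
    harmonicOp N N (radialTerm (cellPoly N) m) z = 0 := by
  have smooth (i : ℕ) : ContDiff ℝ 2 fun z : ℂ =>
      (cellCoeff N i).1 m * (z ^ (m.toNat + i) * conj z ^ ((-m).toNat + i)) :=
    contDiff_const.mul (contDiff_infty.mp (contDiff_pow_mul_conj_pow _ _) 2)
  let E (i : ℕ) : ℂ := i * (m.natAbs + i) * (cellCoeff N i).1 m *
    (z ^ (m.toNat + i - 1) * conj z ^ ((-m).toNat + i - 1))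
  have telescope (i : ℕ) : harmonicOp N N (fun z => (cellCoeff N i).1 m *
      (z ^ (m.toNat + i) * conj z ^ ((-m).toNat + i))) z = E i - E (i + 1) := by
    rw [harmonicOp_cellCoeff_mul]
    simp only [E, ← add_assoc, Nat.add_sub_cancel]
    push_cast
    ring
  have last_eq_zero : (cellCoeff N (N + 1)).1 m = 0 :=
    ordinaryHypergeometricCoefficient_neg_natCast_eq_zero N.lt_succ_self _ _
  rw [funext (radialTerm_cellPoly N m), harmonicOp_sum _ _ _ fun i _ => smooth i,
    Finset.sum_congr rfl fun i _ => telescope i, Finset.sum_range_sub']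
  simp [E, last_eq_zero]

theorem isGenHarmonic_radialSum_C_mul_cellPoly (N : ℕ) (a : subexponential) :
    IsGenHarmonic N N (radialSum (C a * cellPoly N)) :=
  (smoothlySummableOn_radialTerm _).isGenHarmonic_tsum fun m z _ => by
    rw [funext (radialTerm_C_mul a _ m), harmonicOp_const_mul, harmonicOp_radialTerm_cellPoly,
      mul_zero]

/-! ### The cellular decomposition -/

lemma natCast_sub_one_sub {n j : ℕ} (hj : j < n) : ((n - 1 - j : ℕ) : ℂ) = n - 1 - j := by
  rw [Nat.cast_sub (by lia), Nat.cast_sub (by lia), Nat.cast_one]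

lemma cellTerm_eq_radialTerm {n j : ℕ} (hj : j < n) (m : ℤ) (z : ℂ) :
    cellTerm n j m z = radialTerm (cellPoly (n - 1 - j)) m z := by
  have cast_sub := natCast_sub_one_sub hj
  have first : -(n : ℂ) + 1 + j = -((n - 1 - j : ℕ) : ℂ) := by rw [cast_sub]; ring
  have second : (m.natAbs : ℂ) - n + 1 + j = m.natAbs - (n - 1 - j : ℕ) := by rw [cast_sub]; ring
  rw [cellTerm, first, second, ordinaryHypergeometric_neg_natCast, radialTerm, cellPoly,
    eval₂_finsetSum]
  simp only [eval₂_mul, eval₂_C, eval₂_X_pow]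
  rfl

theorem exists_radialSum_eq_sum_cells {n : ℕ} {Q : subexponential[X]} (hQ : Q.degree < n) :
    ∃ k : ℕ → subexponential, ∀ z ∈ unitDisc, radialSum Q z =
      ∑ j ∈ Finset.range n,
        (1 - (‖z‖ : ℂ) ^ 2) ^ j * radialSum (C (k j) * cellPoly (n - 1 - j)) z := by
  obtain ⟨k, Q_eq⟩ := exists_eq_sum_C_sub_X_pow_mul 1 n (fun j => cellPoly (n - 1 - j))
    (fun j _ => isUnit_eval_one_cellPoly _)
    (fun j hj => by have := natDegree_cellPoly_le (n - 1 - j); lia) Q hQ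
  refine ⟨k, fun z hz => ?_⟩
  rw [Q_eq, radialSum_sum _ _ hz]
  refine Finset.sum_congr rfl fun j _ => ?_
  have factor : C (k j) * (C 1 - X) ^ j * cellPoly (n - 1 - j) =
      ((1 - X : ℂ[X]) ^ j).map (algebraMap ℂ subexponential) *
        (C (k j) * cellPoly (n - 1 - j)) := by
    simp only [Polynomial.map_pow, Polynomial.map_sub, Polynomial.map_one, map_X, C_1]
    ring
  rw [factor, radialSum_map_algebraMap_mul]
  simp only [eval_pow, eval_sub, eval_one, eval_X]

theorem mainTheorem3 (n : ℕ) (hn : 0 < n) (u : ℂ → ℂ) (hu : IsPolyharmonic n u) :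
    ∃ (k : ℤ → Fin n → ℂ) (w : Fin n → ℂ → ℂ),
      (∀ z ∈ unitDisc, u z = ∑ j : Fin n, (1 - (‖z‖ : ℂ) ^ 2) ^ (j : ℕ) * w j z) ∧
      ∀ j : Fin n,
        RootLimsupLeOne (fun m => k m j) ∧
        HasSmoothSum (fun m z => k m j * cellTerm n j m z) (w j) ∧
        IsGenHarmonic ((n : ℂ) - 1 - (j : ℕ)) ((n : ℂ) - 1 - (j : ℕ)) (w j) := by
  obtain ⟨Q, degree_lt, expansion⟩ := hu.isAlmansiSum.hasRadialExpansion
  obtain ⟨k, decomposition⟩ := exists_radialSum_eq_sum_cells degree_lt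
  refine ⟨fun m j => (k j).1 m, fun j => radialSum (C (k j) * cellPoly (n - 1 - j)),
    fun z hz => ?_, fun j => ⟨rootLimsupLeOne_of_mem_subexponential (k j).2, ?_, ?_⟩⟩
  · rw [expansion z hz, decomposition z hz, Finset.sum_range]
  · simp only [cellTerm_eq_radialTerm j.2, ← radialTerm_C_mul]
    exact (smoothlySummableOn_radialTerm _).hasSmoothSum
  · rw [← natCast_sub_one_sub j.2]
    exact isGenHarmonic_radialSum_C_mul_cellPoly _ _
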